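/- Let $f=\sum_{j=1}^{p} f^{(j)}$ on $\mathbb{R}^N$, where $f^{(j)}=\sum_{l=1}^{m_j} f^{(j)}_l$ is the function of partition $j$, which has $m_j$ workers, and let $\mathcal X^*$ be the set of minimizers of $f$. There are $n$ servers $V=\{1,\dots,n\}$. **Functions.** Each $f^{(j)}$ is strongly convex and differentiable with $L$-Lipschitz gradient on $\mathbb{R}^N$, with $\|\nabla f^{(j)}\|\le G$ on a closed convex set $\mathcal X\supset\mathcal X^*$; each $f^{(j)}_l$ is differentiable with $L$-Lipschitz gradient on $\mathbb R^N$. There are $x^*\in\mathcal X^*$ and minimizers $x^{(j)}$ of $f^{(j)}$ with $f^{(j)}(x^*)=f^{(j)}(x^{(j)})$ for all $j$. **Weights.** $W(k)$, $k\ge 0$, are deterministic nonnegative $n\times n$ matrices with all row sums equal to $1$; for some $\nu\in(0,1)$ all positive entries of all $W(k)$ are at least $\nu$; and the weights allow consensus: for every $\varepsilon>0$ there is $K$ such that for all $r\ge 0$ and $k\ge K$ any two rows of $W(r+k-1)\cdots W(r+1)W(r)$ differ by at most $\varepsilon$ entrywise. **Gradient codes.** For each partition $j$, which tolerates $s_j<m_j$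 stragglers, there are an encoding matrix $B^{(j)}\in\mathbb{R}^{m_j\times m_j}$ and a decoding matrix $A^{(j)}$ with one row $A^{(j)}_I$ for every set $I$ of $m_j-s_j$ workers of the partition, such that $A^{(j)}_I$ vanishes outside $I$ and $A^{(j)}B^{(j)}$ is the all-ones matrix. The coded gradient of worker $w$ at $y$ is $\nabla g^{(j)}_w(y)=\sum_l B^{(j)}_{w,l}\nabla f^{(j)}_l(y)$. **Choice of partition.** On a probability space with a filtration $(\mathcal F_k)$, server $i$ chooses at iteration $k$ an element of $\{0,1,\dots,p\}$ ($0$ meaning no connection); the choice is $\mathcal F_{k+1}$-measurable and, conditionally on $\mathcal F_k$, equals $j$ with probability $\gamma_{(j)}$, where $\gamma_{(j)}\ge 0$, $\sum_{j=0}^p\gamma_{(j)}=1$ and $\gamma_{(0)}<1$. **Stepsizes.** $\alpha_k>0$, $\alpha_k\to0$, $\sum_k\alpha_k=\infty$, $\sum_k\alpha_k^2<\infty$. **Iteration (SRDO).** The $v_i(0)$ are arbitrary. If server $i$ has no connection at iteration $k$, then $x_i(k+1)=v_i(k)$. If it is connected to partition $j$, it receives the coded gradients of a set $\Gamma_i(k)$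 of workers of $j$ that contains a set $I$ of $m_j-s_j$ workers, and $$x_i(k+1)=v_i(k)-\alpha_k\sum_{w\in\Gamma_i(k)}A^{(j)}_{I,w}\,\nabla g^{(j)}_w\big(v_{q}(\tau)\big),$$ where the server $q=q(i,k,w)$ and the time $\tau=\tau(i,k,w)$ with $0\le\tau\le k\le\tau+H$ at which worker $w$ evaluated its coded gradient are arbitrary, as are the received sets; $H$ is a fixed bound on the delays. Finally $v_i(k+1)=\sum_{l=1}^n W_{il}(k+1)\,x_l(k+1)$. **Conclusion.** With probability $1$ the sequences $\{x_i(k)\}_k$ and $\{v_i(k)\}_k$, for all $i\in V$, converge to the same random point of $\mathcal X^*$. -/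

import Mathlib

open MeasureTheory ProbabilityTheory Filter Topology

noncomputable section

namespace SRDO

/-- The decision space `ℝ^N` with its Euclidean norm. -/
abbrev Point (N : ℕ) : Type := EuclideanSpace ℝ (Fin N)

/-- A gradient code for a partition with `m` workers and `m` local functions that tolerates `s`
stragglers: an encoding matrix `B` (row `w` holds the coefficients used by worker `w`) and a
decoding matrix `A` with one row for every set `I` of `m - s` workers.  Row `I` of `A` only uses
the workers in `I`, and `A * B` is the all-ones matrix. -/
structure GradientCode (m s : ℕ) where
  /-- the encoding matrix -/
  B : Matrix (Fin m) (Fin m) ℝ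
  /-- the decoding matrix, rows indexed by the sets of `m - s` workers -/
  A : Matrix {I : Finset (Fin m) // I.card = m - s} (Fin m) ℝ
  straggler_lt : s < m
  support_subset : ∀ I w, w ∉ I.1 → A I w = 0
  decode : A * B = Matrix.of fun _ _ => (1 : ℝ)

variable {N n p : ℕ}

/-- The coded gradient of worker `w`, evaluated at the point `y`:
`∑ l, B w l • ∇ f_l (y)`, where `f_l` are the local functions of the partition. -/
def GradientCode.codedGradient {m s : ℕ} (C : GradientCode m s) (f : Fin m → Point N → ℝ)
    (w : Fin m) (y : Point N) : Point N :=
  ∑ l, C.B w l • gradient (f l) y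

/-- The gradient decoded by a server from the coded gradients of the workers in `Γ`, with the row
`I` of the decoding matrix, when worker `w` has evaluated its coded gradient at `y w`. -/
def GradientCode.decodedGradient {m s : ℕ} (C : GradientCode m s) (f : Fin m → Point N → ℝ)
    (I : {I : Finset (Fin m) // I.card = m - s}) (Γ : Finset (Fin m)) (y : Fin m → Point N) :
    Point N :=
  ∑ w ∈ Γ, C.A I w • C.codedGradient f w (y w)

/-- The function `f^{(j)} = ∑ l, f^{(j)}_l` of partition `j`. -/
def partitionFun {m : Fin p → ℕ} (f : ∀ j, Fin (m j) → Point N → ℝ) (j : Fin p) :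
    Point N → ℝ :=
  fun x => ∑ l, f j l x

/-- The global objective function `∑ j, f^{(j)}`. -/
def objective {m : Fin p → ℕ} (f : ∀ j, Fin (m j) → Point N → ℝ) : Point N → ℝ :=
  fun x => ∑ j, partitionFun f j x

/-- The set of global minimizers of the objective. -/
def optimalSet {m : Fin p → ℕ} (f : ∀ j, Fin (m j) → Point N → ℝ) : Set (Point N) :=
  {x | ∀ y, objective f x ≤ objective f y}

/-- Assumptions on the functions: the partition functions are convex, differentiable, with
`L`-Lipschitz gradients on the whole space, and with gradients bounded by `G` on a closed convex
set `X` that contains the optimal set; the local functions that the workers differentiate are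
themselves differentiable with `L`-Lipschitz gradients. -/
structure FunctionAssumptions {m : Fin p → ℕ} (f : ∀ j, Fin (m j) → Point N → ℝ)
    (X : Set (Point N)) (L G : ℝ) : Prop where
  convex : ∀ j, ConvexOn ℝ Set.univ (partitionFun f j)
  differentiable : ∀ j, Differentiable ℝ (partitionFun f j)
  lipschitz : ∀ j x y,
    ‖gradient (partitionFun f j) x - gradient (partitionFun f j) y‖ ≤ L * ‖x - y‖
  isClosed_set : IsClosed X
  convex_set : Convex ℝ X
  optimalSet_subset : optimalSet f ⊆ X
  bounded : ∀ j, ∀ x ∈ X, ‖gradient (partitionFun f j) x‖ ≤ G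
  local_differentiable : ∀ j l, Differentiable ℝ (f j l)
  local_lipschitz : ∀ j l x y,
    ‖gradient (f j l) x - gradient (f j l) y‖ ≤ L * ‖x - y‖

/-- The matrix of `k` averaging steps starting at time `r`:
`W (r + k - 1) * ⋯ * W (r + 1) * W r`. -/
def averagingProduct (W : ℕ → Matrix (Fin n) (Fin n) ℝ) (r : ℕ) : ℕ → Matrix (Fin n) (Fin n) ℝ
  | 0 => 1
  | k + 1 => W (r + k) * averagingProduct W r k

/-- The weights allow consensus: the averaging iteration `z ← W z` brings all servers to agreement,
uniformly in the starting time.  Equivalently, the rows of the product of `k` successive weight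
matrices become equal as `k → ∞`, uniformly in the starting time. -/
def AllowsConsensus (W : ℕ → Matrix (Fin n) (Fin n) ℝ) : Prop :=
  ∀ ε > 0, ∃ K : ℕ, ∀ r : ℕ, ∀ k ≥ K, ∀ i i' l,
    |averagingProduct W r k i l - averagingProduct W r k i' l| ≤ ε

/-- Assumptions on the consensus weights `W k`: row-stochastic matrices, whose positive entries
are bounded below by some `ν ∈ (0,1)`, and which allow consensus.  (Server `i` receives from
server `l` at time `k` only if `W k i l ≠ 0`; the topology is otherwise arbitrary.) -/
structure WeightAssumptions (W : ℕ → Matrix (Fin n) (Fin n) ℝ) : Prop where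
  nonneg : ∀ k i l, 0 ≤ W k i l
  row_sum : ∀ k i, ∑ l, W k i l = 1
  lower_bound : ∃ ν ∈ Set.Ioo (0 : ℝ) 1, ∀ k i l, 0 < W k i l → ν ≤ W k i l
  consensus : AllowsConsensus W

/-- Random choice of partitions: `sel k i` is the partition to which server `i` is connected at
iteration `k` (`none` if there is no connection).  Given the history `ℱ k` of the choices made
before iteration `k`, server `i` is connected to partition `j` with probability `γ (some j)` and
to no partition with probability `γ none < 1`. -/
structure SelectionAssumptions {Ω : Type*} [mΩ : MeasurableSpace Ω] (μ : Measure Ω)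
    (ℱ : Filtration ℕ mΩ) (γ : Option (Fin p) → ℝ)
    (sel : ℕ → Fin n → Ω → Option (Fin p)) : Prop where
  prob_nonneg : ∀ o, 0 ≤ γ o
  prob_sum : ∑ o, γ o = 1
  none_lt_one : γ none < 1
  adapted : ∀ k i o, MeasurableSet[ℱ (k + 1)] {ω | sel k i ω = o}
  cond_prob : ∀ k i o, μ⟦{ω | sel k i ω = o} | ℱ k⟧ =ᵐ[μ] fun _ => γ o

/-- Diminishing stepsizes, common to all servers. -/
structure StepsizeAssumptions (α : ℕ → ℝ) : Prop where
  pos : ∀ k, 0 < α k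
  tendsto_zero : Tendsto α atTop (𝓝 0)
  not_summable : ¬ Summable α
  summable_sq : Summable fun k => α k ^ 2

/-- The sequences `x k i` and `v k i` (iteration `k`, server `i`) are generated by the algorithm
with coded and delayed gradients, delays being bounded by `H`.

If server `i` is connected to no partition at iteration `k`, it keeps its weighted average.  If it
is connected to partition `j`, it receives the coded gradients of the workers in `Γ k i j`, where
worker `w` has evaluated its coded gradient at the weighted average of server `src k i j w` at
iteration `time k i j w ∈ [k - H, k]`.  It decodes the gradient with a row of the decoding matrix
that only uses received coded gradients, and makes a gradient step from its own weighted average.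
Then the servers average their estimates.  The sets `Γ`, the sources and the evaluation times are
otherwise arbitrary, and the initial averages `v 0 i` are arbitrary. -/
structure IsRun {Ω : Type*} {m s : Fin p → ℕ} (code : ∀ j, GradientCode (m j) (s j))
    (f : ∀ j, Fin (m j) → Point N → ℝ) (W : ℕ → Matrix (Fin n) (Fin n) ℝ) (α : ℕ → ℝ) (H : ℕ)
    (sel : ℕ → Fin n → Ω → Option (Fin p))
    (Γ : ℕ → Fin n → (j : Fin p) → Ω → Finset (Fin (m j)))
    (src : ℕ → Fin n → (j : Fin p) → Fin (m j) → Ω → Fin n)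
    (time : ℕ → Fin n → (j : Fin p) → Fin (m j) → Ω → ℕ)
    (x v : ℕ → Fin n → Ω → Point N) : Prop where
  delay : ∀ k i j w ω, sel k i ω = some j → w ∈ Γ k i j ω →
    time k i j w ω ≤ k ∧ k ≤ time k i j w ω + H
  step_none : ∀ k i ω, sel k i ω = none → x (k + 1) i ω = v k i ω
  step_some : ∀ k i j ω, sel k i ω = some j →
    ∃ I : {I : Finset (Fin (m j)) // I.card = m j - s j}, I.1 ⊆ Γ k i j ω ∧
      x (k + 1) i ω = v k i ω - α k • (code j).decodedGradient (f j) I (Γ k i j ω)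
        (fun w => v (time k i j w ω) (src k i j w ω) ω)
  average : ∀ k i ω, v (k + 1) i ω = ∑ l, W (k + 1) i l • x (k + 1) l ω

end SRDO

end

noncomputable section

namespace SRDO

/-! ### Real sequences -/

/-! The hypotheses make `xstar` a minimizer of every partition function, and strong convexity makes
each partition gradient at a point v have inner product at least (σ/2)‖v - xstar‖² with v - xstar.
So a step towards any partition, whichever one is drawn, contracts towards `xstar`; the limit is
deterministic, and chance only decides whether enough steps are made.

Averaging is handled by an absolute probability sequence π with π(r+1) W(r) = π(r). By Jensen, V(k)
= ∑ π(k+1, l) ‖v(k, l) - xstar‖² does not grow under averaging, although W need not be doubly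
stochastic. Decoding is exact when all workers evaluate at the same point, so delays only cost a
Lipschitz constant times the recent variation of the averages.

The iterates are not known to be bounded beforehand, so all errors are measured relative to R(k),
the largest distance to `xstar` so far (at least 1). Steps are O(α(k) R(k)); consensus halves the
disagreement every K iterations up to such terms, so disagreement and delay variation are b(k) R(k)
with b square summable. This gives V(k+1) ≤ V(k) - c α(k) Z(k) V(k) + e(k) R(k)², where c > 0, e is
summable and Z(k) is the π-weight of the connected servers. Discarding the descent term bounds R
(`exists_runningBound_le`); then V → 0 (`tendsto_zero_of_descent`) wherever ∑ α Z = ∞, which holds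
almost surely (`ae_not_summable_connected`). -/

theorem summable_of_le_half_add {y c : ℕ → ℝ} (K : ℕ) (hy : ∀ k, 0 ≤ y k) (hc : Summable c)
    (hc0 : ∀ k, 0 ≤ c k) (h : ∀ k, y (k + K) ≤ y k / 2 + c k) : Summable y := by
  refine summable_of_sum_range_le (c := 2 * (∑ k ∈ Finset.range K, y k + ∑' k, c k)) hy fun n => ?_
  -- Shifting the partial sum by K bounds it by a constant plus half of itself; absorbing that half
  -- yields the factor 2.
  have h1 : ∑ k ∈ Finset.range n, y k ≤ ∑ k ∈ Finset.range (K + n), y k :=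
    Finset.sum_le_sum_of_subset_of_nonneg (Finset.range_mono (by omega)) fun _ _ _ => hy _
  rw [Finset.sum_range_add] at h1
  have h2 : ∑ k ∈ Finset.range n, y (K + k) ≤ ∑ k ∈ Finset.range n, (y k / 2 + c k) :=
    Finset.sum_le_sum fun k _ => by rw [add_comm K k]; exact h k
  rw [Finset.sum_add_distrib, ← Finset.sum_div] at h2
  have h3 := hc.sum_le_tsum (Finset.range n) fun k _ => hc0 k
  linarith

theorem summable_sq_add {a b : ℕ → ℝ} (ha : Summable fun k => a k ^ 2)
    (hb : Summable fun k => b k ^ 2) : Summable fun k => (a k + b k) ^ 2 := by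
  refine Summable.of_nonneg_of_le (fun k => sq_nonneg _) (fun k => ?_)
    ((ha.add hb).mul_left 2)
  nlinarith [sq_nonneg (a k - b k)]

theorem summable_sq_const_mul {a : ℕ → ℝ} (c : ℝ) (ha : Summable fun k => a k ^ 2) :
    Summable fun k => (c * a k) ^ 2 := by
  simpa only [mul_pow] using ha.mul_left (c ^ 2)

theorem summable_sq_sum {ι : Type*} (s : Finset ι) {a : ι → ℕ → ℝ}
    (ha : ∀ i ∈ s, Summable fun k => a i k ^ 2) : Summable fun k => (∑ i ∈ s, a i k) ^ 2 := by
  classical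
  induction s using Finset.induction_on with
  | empty => simp
  | insert i s hi ih =>
    simp only [Finset.sum_insert hi]
    exact summable_sq_add (ha i (by simp)) (ih fun j hj => ha j (by simp [hj]))

theorem summable_sq_shift_add {a : ℕ → ℝ} (s : ℕ) (ha : Summable fun k => a k ^ 2) :
    Summable fun k => a (k + s) ^ 2 :=
  (summable_nat_add_iff (f := fun k => a k ^ 2) s).2 ha

theorem summable_sq_shift_sub {a : ℕ → ℝ} (s : ℕ) (ha : Summable fun k => a k ^ 2) :
    Summable fun k => a (k - s) ^ 2 :=
  (summable_nat_add_iff (f := fun k => a (k - s) ^ 2) s).1 (by simpa using ha)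

theorem summable_mul_of_sq {a b : ℕ → ℝ} (ha0 : ∀ k, 0 ≤ a k) (hb0 : ∀ k, 0 ≤ b k)
    (ha : Summable fun k => a k ^ 2) (hb : Summable fun k => b k ^ 2) :
    Summable fun k => a k * b k := by
  refine Summable.of_nonneg_of_le (fun k => mul_nonneg (ha0 k) (hb0 k)) (fun k => ?_) (ha.add hb)
  nlinarith [sq_nonneg (a k - b k), sq_nonneg (a k), sq_nonneg (b k)]

theorem tendsto_zero_of_summable_sq {a : ℕ → ℝ} (ha : Summable fun k => a k ^ 2) :
    Tendsto a atTop (𝓝 0) := by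
  have h := ha.tendsto_atTop_zero.sqrt
  simp only [Real.sqrt_sq_eq_abs, Real.sqrt_zero] at h
  exact (tendsto_zero_iff_abs_tendsto_zero _).2 h

/-- A nonnegative sequence that decreases by the fraction `z k`, up to summable errors, tends to
zero when `∑ z = ∞`. -/
theorem tendsto_zero_of_descent {V z e : ℕ → ℝ} (hV : ∀ k, 0 ≤ V k) (hz : ∀ k, 0 ≤ z k)
    (hzsum : ¬ Summable z) (he0 : ∀ k, 0 ≤ e k) (he : Summable e)
    (h : ∀ k, V (k + 1) ≤ V k - z k * V k + e k) : Tendsto V atTop (𝓝 0) := by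
  have hle : ∀ n, ∑ k ∈ Finset.range n, e k ≤ ∑' k, e k := fun n =>
    he.sum_le_tsum _ fun k _ => he0 k
  -- V minus its accumulated errors is nonincreasing and bounded below, so V converges.
  have hanti : Antitone fun n => V n - ∑ k ∈ Finset.range n, e k := by
    refine antitone_nat_of_succ_le fun n => ?_
    rw [Finset.sum_range_succ]
    linarith [h n, mul_nonneg (hz n) (hV n)]
  have hbdd : BddBelow (Set.range fun n => V n - ∑ k ∈ Finset.range n, e k) := by
    refine ⟨-∑' k, e k, ?_⟩
    rintro _ ⟨n, rfl⟩
    simp only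
    linarith [hV n, hle n]
  have hlim := (tendsto_atTop_ciInf hanti hbdd).add he.hasSum.tendsto_sum_nat
  simp only [sub_add_cancel] at hlim
  set c := (⨅ n, (V n - ∑ k ∈ Finset.range n, e k)) + ∑' k, e k with hc
  have hc0 : 0 ≤ c := ge_of_tendsto' hlim hV
  rcases hc0.eq_or_lt with hc0 | hc0
  · rwa [← hc0] at hlim
  -- Telescoping makes ∑ z V finite; with V eventually at least c/2, ∑ z would be finite too.
  · refine absurd ?_ hzsum
    have hzV : Summable fun k => z k * V k := by
      refine summable_of_sum_range_le (c := V 0 + ∑' k, e k)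
        (fun k => mul_nonneg (hz k) (hV k)) fun n => ?_
      have : ∀ n, ∑ k ∈ Finset.range n, z k * V k ≤ V 0 - V n + ∑ k ∈ Finset.range n, e k := by
        intro n
        induction n with
        | zero => simp
        | succ n ih =>
          rw [Finset.sum_range_succ, Finset.sum_range_succ]
          linarith [h n]
      linarith [this n, hle n, hV n]
    obtain ⟨k0, hk0⟩ := eventually_atTop.1 (hlim.eventually (eventually_ge_nhds (half_lt_self hc0)))
    refine (summable_nat_add_iff k0).1 (Summable.of_nonneg_of_le (fun k => hz _) (fun k => ?_)
      (((summable_nat_add_iff k0).2 hzV).mul_left (2 / c)))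
    have h1 : z (k + k0) * (c / 2) ≤ z (k + k0) * V (k + k0) :=
      mul_le_mul_of_nonneg_left (hk0 (k + k0) (by omega)) (hz _)
    calc z (k + k0) = 2 / c * (z (k + k0) * (c / 2)) := by field_simp
      _ ≤ _ := mul_le_mul_of_nonneg_left h1 (by positivity)

/-! ### Averages with convex weights -/

section Averages

variable {n : ℕ} {E : Type*} [NormedAddCommGroup E] [InnerProductSpace ℝ E]

theorem norm_weighted_sum_sub_le {w : Fin n → ℝ} (hw : ∀ l, 0 ≤ w l) (hw1 : ∑ l, w l = 1)
    {z z' : Fin n → E} {D : ℝ} (h : ∀ l, ‖z l - z' l‖ ≤ D) :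
    ‖∑ l, w l • z l - ∑ l, w l • z' l‖ ≤ D := by
  rw [← Finset.sum_sub_distrib]
  calc ‖∑ l, (w l • z l - w l • z' l)‖ ≤ ∑ l, w l * D := by
        refine norm_sum_le_of_le _ fun l _ => ?_
        rw [← smul_sub, norm_smul, Real.norm_of_nonneg (hw l)]
        exact mul_le_mul_of_nonneg_left (h l) (hw l)
    _ = D := by rw [← Finset.sum_mul, hw1, one_mul]

theorem norm_weighted_sum_sub_const_le {w : Fin n → ℝ} (hw : ∀ l, 0 ≤ w l) (hw1 : ∑ l, w l = 1)
    {z : Fin n → E} {y : E} {D : ℝ} (h : ∀ l, ‖z l - y‖ ≤ D) : ‖∑ l, w l • z l - y‖ ≤ D := by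
  have := norm_weighted_sum_sub_le hw hw1 (z' := fun _ => y) h
  rwa [← Finset.sum_smul, hw1, one_smul] at this

theorem norm_sq_weighted_sum_le {w : Fin n → ℝ} (hw : ∀ l, 0 ≤ w l) (hw1 : ∑ l, w l = 1)
    (z : Fin n → E) : ‖∑ l, w l • z l‖ ^ 2 ≤ ∑ l, w l * ‖z l‖ ^ 2 := by
  have h := ((convexOn_univ_norm (E := E)).pow (fun _ _ => norm_nonneg _) 2).map_sum_le
    (t := Finset.univ) (w := w) (p := z) (fun l _ => hw l) hw1 (fun l _ => Set.mem_univ _)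
  simpa using h

/-- The weight differences sum to zero, so a reference point can be subtracted and only the diameter
matters. -/
theorem norm_weighted_sum_sub_weighted_sum_le [NeZero n] {w w' : Fin n → ℝ}
    (hw : ∑ l, w l = 1) (hw' : ∑ l, w' l = 1) {ε D : ℝ} (hww' : ∀ l, |w l - w' l| ≤ ε)
    {z : Fin n → E} (h : ∀ l l', ‖z l - z l'‖ ≤ D) :
    ‖∑ l, w l • z l - ∑ l, w' l • z l‖ ≤ n * (ε * D) := by
  have h0 : ∑ l, w l • z l - ∑ l, w' l • z l = ∑ l, (w l - w' l) • (z l - z 0) := by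
    simp only [sub_smul, smul_sub, Finset.sum_sub_distrib, ← Finset.sum_smul, hw, hw']
    abel
  rw [h0]
  calc ‖∑ l, (w l - w' l) • (z l - z 0)‖ ≤ ∑ _l : Fin n, ε * D := by
        refine norm_sum_le_of_le _ fun l _ => ?_
        rw [norm_smul, Real.norm_eq_abs]
        exact mul_le_mul (hww' l) (h l 0) (norm_nonneg _) ((abs_nonneg _).trans (hww' l))
    _ = n * (ε * D) := by simp

end Averages

/-! ### Products of the weight matrices -/

section Products

variable {n : ℕ} {W : ℕ → Matrix (Fin n) (Fin n) ℝ}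

theorem averagingProduct_nonneg (hW : WeightAssumptions W) (r k : ℕ) (i l : Fin n) :
    0 ≤ averagingProduct W r k i l := by
  induction k generalizing i with
  | zero =>
    simp only [averagingProduct, Matrix.one_apply]
    split_ifs <;> norm_num
  | succ k ih =>
    simp only [averagingProduct, Matrix.mul_apply]
    exact Finset.sum_nonneg fun j _ => mul_nonneg (hW.nonneg _ _ _) (ih j)

theorem averagingProduct_row_sum (hW : WeightAssumptions W) (r k : ℕ) (i : Fin n) :
    ∑ l, averagingProduct W r k i l = 1 := by
  induction k generalizing i with
  | zero => simp [averagingProduct, Matrix.one_apply]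
  | succ k ih =>
    simp only [averagingProduct, Matrix.mul_apply]
    rw [Finset.sum_comm]
    simp only [← Finset.mul_sum, ih, mul_one, hW.row_sum]

theorem averagingProduct_succ' (W : ℕ → Matrix (Fin n) (Fin n) ℝ) (r k : ℕ) :
    averagingProduct W r (k + 1) = averagingProduct W (r + 1) k * W r := by
  induction k with
  | zero => simp [averagingProduct]
  | succ k ih =>
    rw [averagingProduct, ih, averagingProduct, Matrix.mul_assoc]
    congr 2
    omega

/-- Rows of longer products are convex combinations of the rows at length k, so they stay in the
same ε-ball. -/
theorem averagingProduct_sub_le (hW : WeightAssumptions W) {r k : ℕ} {ε : ℝ}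
    (h : ∀ i i' l, |averagingProduct W r k i l - averagingProduct W r k i' l| ≤ ε)
    (t : ℕ) (i i' l : Fin n) :
    |averagingProduct W r (k + t) i l - averagingProduct W r k i' l| ≤ ε := by
  induction t generalizing i with
  | zero => exact h i i' l
  | succ t ih =>
    have := norm_weighted_sum_sub_const_le (hW.nonneg (r + (k + t)) i) (hW.row_sum (r + (k + t)) i)
      (z := fun j => averagingProduct W r (k + t) j l) (y := averagingProduct W r k i' l)
      (D := ε) (fun j => ih j)
    rw [← add_assoc, averagingProduct, Matrix.mul_apply]
    exact this

/-- The absolute probability sequence of the weight matrices. -/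
theorem exists_absolute_probability [NeZero n] (hW : WeightAssumptions W) :
    ∃ π : ℕ → Fin n → ℝ, (∀ r l, 0 ≤ π r l) ∧ (∀ r, ∑ l, π r l = 1) ∧
      ∀ r l, ∑ i, π (r + 1) i * W r i l = π r l := by
  -- π(r) is the common limit of the rows of the products started at r; following row 0 suffices.
  have hlim : ∀ r l, ∃ c, Tendsto (fun k => averagingProduct W r k 0 l) atTop (𝓝 c) := by
    intro r l
    refine cauchySeq_tendsto_of_complete (Metric.cauchySeq_iff'.2 fun ε hε => ?_)
    obtain ⟨K, hK⟩ := hW.consensus (ε / 2) (half_pos hε)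
    refine ⟨K, fun k hk => ?_⟩
    obtain ⟨t, rfl⟩ := Nat.exists_eq_add_of_le hk
    rw [Real.dist_eq]
    exact (averagingProduct_sub_le hW (hK r K le_rfl) t 0 0 l).trans_lt (half_lt_self hε)
  choose π hπ using hlim
  refine ⟨π, fun r l => ge_of_tendsto' (hπ r l) fun k => averagingProduct_nonneg hW r k 0 l,
    fun r => ?_, fun r l => ?_⟩
  · refine tendsto_nhds_unique (tendsto_finsetSum Finset.univ fun l _ => hπ r l) ?_
    simp only [averagingProduct_row_sum hW]
    exact tendsto_const_nhds
  · refine tendsto_nhds_unique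
      (tendsto_finsetSum Finset.univ fun i _ => (hπ (r + 1) i).mul_const (W r i l)) ?_
    have := (tendsto_add_atTop_iff_nat 1).2 (hπ r l)
    simpa only [averagingProduct_succ', Matrix.mul_apply] using this

end Products

/-! ### Random choice of partitions -/

/-- Lévy's form of Borel–Cantelli: an adapted nondecreasing sum with bounded increments diverges
almost surely exactly where its compensator does. The compensator here is (1 - γ none) ∑ α. By
linearity only the conditional law of each single server enters, not their joint law. -/
theorem ae_not_summable_connected {n p : ℕ} {Ω : Type*} [mΩ : MeasurableSpace Ω] {μ : Measure Ω}
    [IsProbabilityMeasure μ] {ℱ : Filtration ℕ mΩ} {γ : Option (Fin p) → ℝ}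
    {sel : ℕ → Fin n → Ω → Option (Fin p)} (hsel : SelectionAssumptions μ ℱ γ sel)
    {α : ℕ → ℝ} (hα : StepsizeAssumptions α) {π : ℕ → Fin n → ℝ} (hπ0 : ∀ r l, 0 ≤ π r l)
    (hπ1 : ∀ r, ∑ l, π r l = 1) :
    ∀ᵐ ω ∂μ, ¬ Summable fun k =>
      α k * ∑ l, π k l * (if sel k l ω = none then 0 else 1 : ℝ) := by
  set c : ℕ → Ω → ℝ := fun k ω => α k * ∑ l, π k l * (if sel k l ω = none then 0 else 1 : ℝ)
    with hc
  have hc_eq : ∀ k, c k = fun ω =>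
      α k * (1 - ∑ l, π k l * ({ω | sel k l ω = none}.indicator (fun _ => (1 : ℝ)) ω)) := by
    intro k
    ext ω
    simp only [hc, ← hπ1 k, ← Finset.sum_sub_distrib]
    congr 1
    refine Finset.sum_congr rfl fun l _ => ?_
    by_cases h : sel k l ω = none <;> simp [h, hπ1 k]
  have hc0 : ∀ k ω, 0 ≤ c k ω := fun k ω =>
    mul_nonneg (hα.pos k).le (Finset.sum_nonneg fun l _ =>
      mul_nonneg (hπ0 k l) (by split_ifs <;> norm_num))
  have hcα : ∀ k ω, c k ω ≤ α k := by
    intro k ω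
    have : ∑ l, π k l * (if sel k l ω = none then 0 else 1 : ℝ) ≤ ∑ l, π k l :=
      Finset.sum_le_sum fun l _ => mul_le_of_le_one_right (hπ0 k l) (by split_ifs <;> norm_num)
    rw [hπ1 k] at this
    exact mul_le_of_le_one_right (hα.pos k).le this
  have hcm : ∀ k, StronglyMeasurable[ℱ (k + 1)] (c k) := by
    intro k
    rw [hc_eq k]
    refine StronglyMeasurable.const_mul (StronglyMeasurable.sub stronglyMeasurable_const ?_) _
    refine Finset.stronglyMeasurable_fun_sum _ fun l _ => StronglyMeasurable.const_mul ?_ _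
    exact stronglyMeasurable_const.indicator (hsel.adapted k l none)
  have hci : ∀ k, Integrable (c k) μ := fun k =>
    Integrable.of_bound ((hcm k).mono (ℱ.le _)).aestronglyMeasurable (α k)
      (Eventually.of_forall fun ω => by
        rw [Real.norm_of_nonneg (hc0 k ω)]; exact hcα k ω)
  set f : ℕ → Ω → ℝ := fun N => ∑ k ∈ Finset.range N, c k with hf
  have hfsucc : ∀ N, f (N + 1) - f N = c N := fun N => by
    simp only [hf, Finset.sum_range_succ, add_sub_cancel_left]
  have hcond : ∀ k, μ[c k | ℱ k] =ᵐ[μ] fun _ => α k * (1 - γ none) := by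
    intro k
    have hind : ∀ l, Integrable ({ω | sel k l ω = none}.indicator (fun _ => (1 : ℝ))) μ :=
      fun l => (integrable_const _).indicator (ℱ.le _ _ (hsel.adapted k l none))
    have h1 : c k = α k • ((fun _ => (1 : ℝ)) - ∑ l, π k l •
        ({ω | sel k l ω = none}.indicator (fun _ => (1 : ℝ)))) := by
      rw [hc_eq k]
      ext ω
      simp
    have hint : Integrable (∑ l, π k l •
        ({ω | sel k l ω = none}.indicator (fun _ => (1 : ℝ)))) μ :=
      integrable_finsetSum' _ fun l _ => (hind l).smul (π k l)
    have h2 := condExp_smul (μ := μ) (α k) ((fun _ => (1 : ℝ)) - ∑ l, π k l •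
        ({ω | sel k l ω = none}.indicator (fun _ => (1 : ℝ)))) (ℱ k)
    have h3 := condExp_sub (μ := μ) (integrable_const (1 : ℝ)) hint (ℱ k)
    have h4 := condExp_finsetSum (μ := μ) (s := Finset.univ)
      (fun l _ => (hind l).smul (π k l)) (ℱ k)
    have h5 : ∀ᵐ ω ∂μ, ∀ l, (μ[π k l • ({ω | sel k l ω = none}.indicator
        (fun _ => (1 : ℝ))) | ℱ k]) ω = π k l * γ none := by
      refine ae_all_iff.2 fun l => ?_
      filter_upwards [condExp_smul (μ := μ) (π k l)
        ({ω | sel k l ω = none}.indicator (fun _ => (1 : ℝ))) (ℱ k),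
        hsel.cond_prob k l none] with ω h h'
      rw [h, Pi.smul_apply, smul_eq_mul]
      exact congrArg _ h'
    rw [h1]
    filter_upwards [h2, h3, h4, h5] with ω h2 h3 h4 h5
    rw [h2, Pi.smul_apply, h3, Pi.sub_apply, h4, Finset.sum_apply, condExp_const (ℱ.le k)]
    simp only [h5, ← Finset.sum_mul, hπ1 k, one_mul, smul_eq_mul]
  obtain ⟨A, hA⟩ := hα.tendsto_zero.bddAbove_range
  have hA' : ∀ k, α k ≤ A := fun k => hA ⟨k, rfl⟩
  have hA0 : 0 ≤ A := (hα.pos 0).le.trans (hA' 0)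
  have key := tendsto_sum_indicator_atTop_iff (μ := μ) (ℱ := ℱ) (f := f) (R := ⟨A, hA0⟩)
    (Eventually.of_forall fun ω N => by
      have := congrFun (hfsucc N) ω
      simp only [Pi.sub_apply] at this
      linarith [hc0 N ω])
    (fun N => Finset.stronglyMeasurable_sum _ fun k hk =>
      (hcm k).mono (ℱ.mono (Finset.mem_range.1 hk)))
    (fun N => integrable_finsetSum' _ fun k _ => hci k)
    (Eventually.of_forall fun ω N => by
      have := congrFun (hfsucc N) ω
      simp only [Pi.sub_apply] at this
      rw [this, abs_of_nonneg (hc0 N ω)]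
      exact (hcα N ω).trans (hA' N))
  filter_upwards [key, ae_all_iff.2 hcond] with ω h1 h2
  have hpred : Tendsto (fun N => predictablePart f ℱ μ N ω) atTop atTop := by
    have h3 : ∀ N, predictablePart f ℱ μ N ω
        = (∑ k ∈ Finset.range N, α k) * (1 - γ none) := by
      intro N
      simp only [predictablePart, Finset.sum_apply, hfsucc, h2, Finset.sum_mul]
    simp only [h3]
    exact ((not_summable_iff_tendsto_nat_atTop_of_nonneg fun k => (hα.pos k).le).1
      hα.not_summable).atTop_mul_const (by linarith [hsel.none_lt_one])
  have := h1.2 hpred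
  simp only [hf, Finset.sum_apply] at this
  exact (not_summable_iff_tendsto_nat_atTop_of_nonneg fun k => hc0 k ω).2 this

/-! ### Gradients -/

section Gradients

open scoped RealInnerProductSpace

variable {E : Type*} [NormedAddCommGroup E] [InnerProductSpace ℝ E] [CompleteSpace E]

theorem gradient_finset_sum {ι : Type*} (s : Finset ι) {f : ι → E → ℝ} {x : E}
    (hf : ∀ i ∈ s, DifferentiableAt ℝ (f i) x) :
    gradient (fun y => ∑ i ∈ s, f i y) x = ∑ i ∈ s, gradient (f i) x := by
  simp only [gradient, fderiv_fun_sum hf, map_sum]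

theorem gradient_eq_zero_of_forall_le {f : E → ℝ} {x : E} (h : ∀ y, f x ≤ f y) :
    gradient f x = 0 := by
  have : IsLocalMin f x := Eventually.of_forall h
  simp [gradient, this.fderiv_eq_zero]

/-- The gradient of a strongly convex function at `x` makes an acute angle with the direction from
the minimizer to `x`. -/
theorem inner_gradient_ge_of_strongConvexOn {f : E → ℝ} {σ : ℝ}
    (hf : StrongConvexOn Set.univ σ f) {x z : E} (hd : DifferentiableAt ℝ f x)
    (hz : ∀ y, f z ≤ f y) : σ / 2 * ‖x - z‖ ^ 2 ≤ ⟪gradient f x, x - z⟫ := by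
  have hline : HasDerivAt (fun t : ℝ => f (x + t • (z - x))) ⟪gradient f x, z - x⟫ 0 := by
    have h1 : HasDerivAt (fun t : ℝ => x + t • (z - x)) (z - x) 0 := by
      simpa using ((hasDerivAt_id (0 : ℝ)).smul_const (z - x)).const_add x
    have h2 : HasFDerivAt f (fderiv ℝ f x) (x + (0 : ℝ) • (z - x)) := by
      simpa using hd.hasFDerivAt
    have h3 := h2.comp_hasDerivAt (0 : ℝ) h1
    have h4 : ⟪gradient f x, z - x⟫ = fderiv ℝ f x (z - x) := by
      simp [gradient]
    rw [h4]
    exact h3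
  have hslope := hline.tendsto_slope_zero_right
  have hbound : Tendsto (fun t : ℝ => -((1 - t) * (σ / 2 * ‖x - z‖ ^ 2))) (𝓝[>] 0)
      (𝓝 (-((1 - 0) * (σ / 2 * ‖x - z‖ ^ 2)))) := by
    refine Tendsto.mono_left ?_ nhdsWithin_le_nhds
    exact (Continuous.tendsto (by fun_prop) 0)
  have hle := le_of_tendsto_of_tendsto hslope hbound (by
    have h01 : Set.Ioo (0 : ℝ) 1 ∈ 𝓝[>] (0 : ℝ) := Ioo_mem_nhdsGT one_pos
    filter_upwards [h01] with t ht
    -- Strong convexity on the segment from x to z, divided by t. Discarding f z - f x ≤ 0 leaves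
    -- the constant σ / 2.
    have hc := hf.2 (Set.mem_univ x) (Set.mem_univ z) (sub_nonneg.2 ht.2.le) ht.1.le
      (sub_add_cancel 1 t)
    have heq : (1 - t) • x + t • z = x + t • (z - x) := by
      rw [sub_smul, smul_sub, one_smul]; abel
    rw [heq] at hc
    simp only [smul_eq_mul, zero_add, zero_smul, add_zero] at hc ⊢
    rw [inv_mul_le_iff₀ ht.1]
    nlinarith [hz x, ht.1])
  rw [← neg_sub z x, inner_neg_right, norm_neg, ← norm_neg, neg_sub]
  linarith

end Gradients

/-! ### Gradient codes: exact decoding and sensitivity to stale evaluations -/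

section Codes

variable {N p : ℕ}

theorem gradient_partitionFun {m : Fin p → ℕ} {f : ∀ j, Fin (m j) → Point N → ℝ} {X : Set (Point N)}
    {L G : ℝ} (hf : FunctionAssumptions f X L G) (j : Fin p) (x : Point N) :
    gradient (partitionFun f j) x = ∑ l, gradient (f j l) x :=
  gradient_finset_sum _ fun l _ => (hf.local_differentiable j l).differentiableAt

/-- Row I of A vanishes off I, so the sum over Γ extends to all workers, and the identity for A B
gives every local gradient coefficient 1. -/
theorem GradientCode.decodedGradient_const {m s : ℕ} (C : GradientCode m s)
    (f : Fin m → Point N → ℝ) {I : {I : Finset (Fin m) // I.card = m - s}} {Γ : Finset (Fin m)}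
    (hI : I.1 ⊆ Γ) (y : Point N) :
    C.decodedGradient f I Γ (fun _ => y) = ∑ l, gradient (f l) y := by
  have h1 : ∀ l, ∑ w, C.A I w * C.B w l = 1 := fun l => by
    have := congrFun (congrFun C.decode I) l
    rwa [Matrix.mul_apply] at this
  rw [decodedGradient, Finset.sum_subset (Finset.subset_univ Γ) fun w _ hw => by
    rw [C.support_subset I w fun h => hw (hI h), zero_smul]]
  simp only [codedGradient, Finset.smul_sum, smul_smul]
  rw [Finset.sum_comm]
  simp only [← Finset.sum_smul, h1, one_smul]

/-- The sensitivity of the decoded gradient to the points at which the workers evaluate. -/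
def GradientCode.gain {m s : ℕ} (C : GradientCode m s) : ℝ :=
  ∑ I, ∑ w, |C.A I w| * ∑ l, |C.B w l|

theorem GradientCode.gain_nonneg {m s : ℕ} (C : GradientCode m s) : 0 ≤ C.gain := by
  unfold gain
  positivity

theorem GradientCode.norm_decodedGradient_sub_le {m s : ℕ} (C : GradientCode m s)
    {f : Fin m → Point N → ℝ} {L : ℝ}
    (hf : ∀ l x y, ‖gradient (f l) x - gradient (f l) y‖ ≤ L * ‖x - y‖)
    (I : {I : Finset (Fin m) // I.card = m - s}) (Γ : Finset (Fin m)) {y y' : Fin m → Point N}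
    {D : ℝ} (h : ∀ w ∈ Γ, ‖y w - y' w‖ ≤ D) (hD : 0 ≤ D) :
    ‖C.decodedGradient f I Γ y - C.decodedGradient f I Γ y'‖ ≤ C.gain * (|L| * D) := by
  have hf' : ∀ l, ∀ w ∈ Γ, ‖gradient (f l) (y w) - gradient (f l) (y' w)‖ ≤ |L| * D :=
    fun l w hw => (hf l _ _).trans <|
      (mul_le_mul_of_nonneg_right (le_abs_self L) (norm_nonneg _)).trans
        (mul_le_mul_of_nonneg_left (h w hw) (abs_nonneg L))
  calc ‖C.decodedGradient f I Γ y - C.decodedGradient f I Γ y'‖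
      ≤ ∑ w ∈ Γ, |C.A I w| * ((∑ l, |C.B w l|) * (|L| * D)) := by
        rw [decodedGradient, decodedGradient, ← Finset.sum_sub_distrib]
        refine norm_sum_le_of_le _ fun w hw => ?_
        rw [← smul_sub, norm_smul, Real.norm_eq_abs]
        refine mul_le_mul_of_nonneg_left ?_ (abs_nonneg _)
        rw [codedGradient, codedGradient, ← Finset.sum_sub_distrib, Finset.sum_mul]
        refine norm_sum_le_of_le _ fun l _ => ?_
        rw [← smul_sub, norm_smul, Real.norm_eq_abs]
        exact mul_le_mul_of_nonneg_left (hf' l w hw) (abs_nonneg _)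
    _ ≤ ∑ w, |C.A I w| * ((∑ l, |C.B w l|) * (|L| * D)) :=
        Finset.sum_le_sum_of_subset_of_nonneg (Finset.subset_univ _) fun w _ _ => by positivity
    _ = (∑ w, |C.A I w| * ∑ l, |C.B w l|) * (|L| * D) := by
        rw [Finset.sum_mul]
        exact Finset.sum_congr rfl fun w _ => by ring
    _ ≤ C.gain * (|L| * D) := by
        refine mul_le_mul_of_nonneg_right ?_ (by positivity)
        exact Finset.single_le_sum (f := fun I => ∑ w, |C.A I w| * ∑ l, |C.B w l|)
          (fun I _ => by positivity) (Finset.mem_univ I)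

end Codes

/-! ### Averaging with delayed descent steps along one realization -/

section Bounds

variable {n : ℕ} {E : Type*} [NormedAddCommGroup E]

/-- The largest norm up to time `k`, and at least `1`. -/
def runningBound (u : ℕ → Fin n → E) (k : ℕ) : ℝ :=
  ((Finset.range (k + 1) ×ˢ Finset.univ).sup (fun q : ℕ × Fin n => ‖u q.1 q.2‖₊) ⊔ 1 : NNReal)

theorem one_le_runningBound (u : ℕ → Fin n → E) (k : ℕ) : 1 ≤ runningBound u k := by
  rw [runningBound]
  exact_mod_cast le_sup_right

theorem norm_le_runningBound (u : ℕ → Fin n → E) {s k : ℕ} (h : s ≤ k) (i : Fin n) :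
    ‖u s i‖ ≤ runningBound u k := by
  rw [runningBound, ← coe_nnnorm, NNReal.coe_le_coe]
  refine le_trans ?_ le_sup_left
  exact Finset.le_sup (f := fun q : ℕ × Fin n => ‖u q.1 q.2‖₊) (b := (s, i))
    (by simp; omega)

theorem runningBound_le {u : ℕ → Fin n → E} {k : ℕ} {B : ℝ} (hB : 1 ≤ B)
    (h : ∀ s ≤ k, ∀ i, ‖u s i‖ ≤ B) : runningBound u k ≤ B := by
  lift B to NNReal using zero_le_one.trans hB
  rw [runningBound, NNReal.coe_le_coe]
  refine sup_le (Finset.sup_le fun q hq => ?_) (by exact_mod_cast hB)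
  have := h q.1 (by simp at hq; omega) q.2
  exact_mod_cast this

theorem runningBound_mono (u : ℕ → Fin n → E) : Monotone (runningBound u) := fun _ k hk =>
  runningBound_le (one_le_runningBound u k) fun _ hs i => norm_le_runningBound u (hs.trans hk) i

/-- The diameter of a finite family of points. -/
def spread (z : Fin n → E) : ℝ :=
  (Finset.univ.sup (fun q : Fin n × Fin n => ‖z q.1 - z q.2‖₊) : NNReal)

theorem spread_nonneg (z : Fin n → E) : 0 ≤ spread z := NNReal.coe_nonneg _

theorem norm_sub_le_spread (z : Fin n → E) (i i' : Fin n) : ‖z i - z i'‖ ≤ spread z := by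
  rw [spread, ← coe_nnnorm, NNReal.coe_le_coe]
  exact Finset.le_sup (f := fun q : Fin n × Fin n => ‖z q.1 - z q.2‖₊) (Finset.mem_univ (i, i'))

theorem spread_le {z : Fin n → E} {B : ℝ} (hB : 0 ≤ B) (h : ∀ i i', ‖z i - z i'‖ ≤ B) :
    spread z ≤ B := by
  lift B to NNReal using hB
  rw [spread, NNReal.coe_le_coe]
  exact Finset.sup_le fun q _ => by exact_mod_cast h q.1 q.2

/-- A bounded-growth criterion: if the squared norms are controlled by a potential with relatively
summable increments, up to a relatively vanishing error, then they are bounded. -/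
theorem exists_runningBound_le {u : ℕ → Fin n → E} {V a e : ℕ → ℝ} (he0 : ∀ k, 0 ≤ e k)
    (he : Summable e) (ha : Tendsto a atTop (𝓝 0))
    (hVR : ∀ k, V k ≤ runningBound u k ^ 2)
    (huV : ∀ k i, ‖u k i‖ ^ 2 ≤ V k + 2 * a k * runningBound u k ^ 2)
    (hV : ∀ k, V (k + 1) ≤ V k + e k * runningBound u k ^ 2) :
    ∃ B, ∀ k, runningBound u k ≤ B := by
  have hR0 : ∀ k, 0 ≤ runningBound u k := fun k => zero_le_one.trans (one_le_runningBound u k)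
  have hR2 : ∀ {s k}, s ≤ k → runningBound u s ^ 2 ≤ runningBound u k ^ 2 := fun h =>
    pow_le_pow_left₀ (hR0 _) (runningBound_mono u h) 2
  -- The thresholds make the two errors at most R²/4 each: the tail of e directly, and 2a from a ≤
  -- 1/8.
  obtain ⟨k0, hk0⟩ : ∃ k0, (∑' k, e (k + k0)) ≤ 1 / 4 ∧ ∀ k ≥ k0, a k ≤ 1 / 8 := by
    have h1 := (tendsto_sum_nat_add e).eventually (eventually_le_nhds (b := 1 / 4) (by norm_num))
    have h2 := ha.eventually (eventually_le_nhds (b := 1 / 8) (by norm_num))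
    obtain ⟨k0, h⟩ := eventually_atTop.1 (h1.and h2)
    exact ⟨k0, (h k0 le_rfl).1, fun k hk => (h k hk).2⟩
  have hVk : ∀ k t, t ≤ k → V (k0 + t) ≤ runningBound u k0 ^ 2 +
      (∑ s ∈ Finset.range t, e (s + k0)) * runningBound u (k0 + k) ^ 2 := by
    intro k t
    induction t with
    | zero => intro _; simpa using hVR k0
    | succ t ih =>
      intro ht
      rw [Finset.sum_range_succ, add_mul]
      have h1 := ih (by omega)
      have h2 := hV (k0 + t)
      have h3 : e (k0 + t) * runningBound u (k0 + t) ^ 2 ≤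
          e (t + k0) * runningBound u (k0 + k) ^ 2 := by
        rw [add_comm t]
        exact mul_le_mul_of_nonneg_left (hR2 (by omega)) (he0 _)
      rw [← add_assoc]
      linarith
  have hbound : ∀ k, runningBound u (k0 + k) ^ 2 ≤ 2 * runningBound u k0 ^ 2 := by
    intro k
    -- All norms up to time k0 + k are at most √B. Since B contains only half of the squared running
    -- bound, that half is absorbed.
    set B := runningBound u k0 ^ 2 + runningBound u (k0 + k) ^ 2 / 2 with hB
    have h1B : 1 ≤ B := by
      nlinarith [one_le_runningBound u k0, sq_nonneg (runningBound u (k0 + k))]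
    have hsq : ∀ s ≤ k0 + k, ∀ i, ‖u s i‖ ^ 2 ≤ B := by
      intro s hs i
      rcases le_total s k0 with h | h
      · have := pow_le_pow_left₀ (norm_nonneg _) (norm_le_runningBound u h i) 2
        nlinarith [sq_nonneg (runningBound u (k0 + k))]
      · obtain ⟨t, rfl⟩ := Nat.exists_eq_add_of_le h
        have h1 := hVk t t le_rfl
        have h2 := huV (k0 + t) i
        have h3 : ∑ s ∈ Finset.range t, e (s + k0) ≤ 1 / 4 :=
          (((summable_nat_add_iff k0).2 he).sum_le_tsum _ fun _ _ => he0 _).trans hk0.1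
        have h4 := mul_le_mul_of_nonneg_right h3 (sq_nonneg (runningBound u (k0 + t)))
        have h5 := mul_le_mul_of_nonneg_right (hk0.2 (k0 + t) h)
          (sq_nonneg (runningBound u (k0 + t)))
        have h6 := hR2 hs
        linarith
    have hle : runningBound u (k0 + k) ≤ √B :=
      runningBound_le (Real.one_le_sqrt.2 h1B) fun s hs i => Real.le_sqrt_of_sq_le (hsq s hs i)
    have := pow_le_pow_left₀ (hR0 _) hle 2
    rw [Real.sq_sqrt (zero_le_one.trans h1B)] at this
    linarith
  refine ⟨√(2 * runningBound u k0 ^ 2), fun k => ?_⟩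
  exact (runningBound_mono u (Nat.le_add_left k k0)).trans (Real.le_sqrt_of_sq_le (hbound k))

end Bounds

/-! ### The perturbed averaging recursion and its Lyapunov function -/

section Descent

open scoped RealInnerProductSpace

variable {n : ℕ} {E : Type*} [NormedAddCommGroup E] [InnerProductSpace ℝ E]

/-- The deterministic recursion behind the algorithm, centred at the minimizer: servers `l` with
`conn k l` make a step along a direction `g` that approximates a strongly monotone direction `h`
up to the variation of the averages over the last `H` iterations. -/
structure DelayedDescent (W : ℕ → Matrix (Fin n) (Fin n) ℝ) (α : ℕ → ℝ) (H : ℕ)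
    (conn : ℕ → Fin n → Prop) (σ C : ℝ) (u y : ℕ → Fin n → E) : Prop where
  average : ∀ k i, u (k + 1) i = ∑ l, W (k + 1) i l • y k l
  idle : ∀ k l, ¬ conn k l → y k l = u k l
  active : ∀ k l, conn k l → ∃ g h : E, y k l = u k l - α k • g ∧
    σ * ‖u k l‖ ^ 2 ≤ ⟪h, u k l⟫ ∧ ‖h‖ ≤ C * ‖u k l‖ ∧
    ∀ B, (∀ q τ, τ ≤ k → k ≤ τ + H → ‖u τ q - u k l‖ ≤ B) → ‖g - h‖ ≤ C * B

namespace DelayedDescent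

variable {W : ℕ → Matrix (Fin n) (Fin n) ℝ} {α : ℕ → ℝ} {H : ℕ} {conn : ℕ → Fin n → Prop}
  {σ C : ℝ} {u y : ℕ → Fin n → E}

theorem exists_direction (hd : DelayedDescent W α H conn σ C u y) (hC : 0 ≤ C) {k : ℕ} {l : Fin n}
    (hc : conn k l) : ∃ g h : E, y k l = u k l - α k • g ∧ σ * ‖u k l‖ ^ 2 ≤ ⟪h, u k l⟫ ∧
      ‖g‖ ≤ 3 * C * runningBound u k ∧
      ∀ B, (∀ q τ, τ ≤ k → k ≤ τ + H → ‖u τ q - u k l‖ ≤ B) → ‖g - h‖ ≤ C * B := by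
  obtain ⟨g, h, h1, h2, h3, h4⟩ := hd.active k l hc
  refine ⟨g, h, h1, h2, ?_, h4⟩
  -- A crude variation bound 2R gives ‖g - h‖ ≤ 2CR; adding ‖h‖ ≤ CR yields the factor 3.
  have h5 := h4 (2 * runningBound u k) fun q τ hτ _ => (norm_sub_le _ _).trans (by
    linarith [norm_le_runningBound u hτ q, norm_le_runningBound u (le_refl k) l])
  have h6 := mul_le_mul_of_nonneg_left (norm_le_runningBound u (le_refl k) l) hC
  have h7 := norm_add_le (g - h) h
  rw [sub_add_cancel] at h7
  linarith

theorem norm_step_le (hd : DelayedDescent W α H conn σ C u y) (hC : 0 ≤ C) (hα : ∀ k, 0 < α k)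
    (k : ℕ) (l : Fin n) : ‖y k l - u k l‖ ≤ 3 * C * α k * runningBound u k := by
  have hR := one_le_runningBound u k
  by_cases hc : conn k l
  · obtain ⟨g, h, h1, -, h3, -⟩ := hd.exists_direction hC hc
    rw [h1, sub_sub_cancel_left, norm_neg, norm_smul, Real.norm_of_nonneg (hα k).le]
    calc α k * ‖g‖ ≤ α k * (3 * C * runningBound u k) := mul_le_mul_of_nonneg_left h3 (hα k).le
      _ = _ := by ring
  · rw [hd.idle k l hc, sub_self, norm_zero]
    have := hα k
    positivity

/-- Stochastic matrices do not amplify perturbations, so the deviation from pure averaging is at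
most the sum of the step sizes. Products start at k + 1 because `W (k + 1)` is the first matrix
applied after time k. -/
theorem norm_sub_averagingProduct_le (hd : DelayedDescent W α H conn σ C u y)
    (hW : WeightAssumptions W) (hC : 0 ≤ C) (hα : ∀ k, 0 < α k) (k t : ℕ) (i : Fin n) :
    ‖u (k + t) i - ∑ l, averagingProduct W (k + 1) t i l • u k l‖ ≤
      (∑ s ∈ Finset.range t, 3 * C * α (k + s)) * runningBound u (k + t) := by
  induction t generalizing i with
  | zero => simp [averagingProduct, Matrix.one_apply]
  | succ t ih =>
    have h1 : ∑ l, averagingProduct W (k + 1) (t + 1) i l • u k l =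
        ∑ j, W (k + t + 1) i j • ∑ l, averagingProduct W (k + 1) t j l • u k l := by
      simp only [averagingProduct, Matrix.mul_apply, Finset.sum_smul, Finset.smul_sum, smul_smul]
      rw [Finset.sum_comm, add_right_comm k 1 t]
    rw [h1, ← add_assoc, hd.average]
    refine norm_weighted_sum_sub_le (hW.nonneg _ i) (hW.row_sum _ i) fun j => ?_
    have h2 := norm_sub_le_norm_sub_add_norm_sub (y (k + t) j) (u (k + t) j)
      (∑ l, averagingProduct W (k + 1) t j l • u k l)
    have h3 := hd.norm_step_le hC hα (k + t) j
    have h4 := ih j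
    have h5 : (∑ s ∈ Finset.range (t + 1), 3 * C * α (k + s)) * runningBound u (k + t) ≤
        (∑ s ∈ Finset.range (t + 1), 3 * C * α (k + s)) * runningBound u (k + t + 1) :=
      mul_le_mul_of_nonneg_left (runningBound_mono u (Nat.le_succ _))
        (Finset.sum_nonneg fun s _ => mul_nonneg (by linarith) (hα _).le)
    refine le_trans ?_ h5
    rw [Finset.sum_range_succ, add_mul]
    linarith

/-- The relative disagreement of the servers is square summable. -/
theorem summable_sq_spread_div [NeZero n] (hd : DelayedDescent W α H conn σ C u y)
    (hW : WeightAssumptions W) (hC : 0 ≤ C) (hα : StepsizeAssumptions α) :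
    Summable fun k => (spread (u k) / runningBound u k) ^ 2 := by
  have hR : ∀ k, 0 < runningBound u k := fun k =>
    zero_lt_one.trans_le (one_le_runningBound u k)
  have hn : (0 : ℝ) < n := Nat.cast_pos.2 (NeZero.pos n)
  -- This tolerance turns n · ε · spread into half the spread.
  obtain ⟨K, hK⟩ := hW.consensus (1 / (2 * n)) (by positivity)
  set c : ℕ → ℝ := fun k => ∑ s ∈ Finset.range K, 3 * C * α (k + s) with hc
  have hc0 : ∀ k, 0 ≤ c k := fun k =>
    Finset.sum_nonneg fun s _ => mul_nonneg (by linarith) (hα.pos _).le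
  have hcs : Summable fun k => c k ^ 2 :=
    summable_sq_sum _ fun s _ => summable_sq_const_mul (3 * C)
      (summable_sq_shift_add s hα.summable_sq)
  have hrec : ∀ k, spread (u (k + K)) / runningBound u (k + K) ≤
      spread (u k) / runningBound u k / 2 + 2 * c k := by
    intro k
    have h1 : spread (u (k + K)) ≤ spread (u k) / 2 + 2 * (c k * runningBound u (k + K)) := by
      refine spread_le (add_nonneg (div_nonneg (spread_nonneg _) zero_le_two)
        (mul_nonneg zero_le_two (mul_nonneg (hc0 k) (hR _).le))) fun i i' => ?_
      have h2 := hd.norm_sub_averagingProduct_le hW hC hα.pos k K i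
      have h3 := hd.norm_sub_averagingProduct_le hW hC hα.pos k K i'
      have h4 := norm_weighted_sum_sub_weighted_sum_le
        (averagingProduct_row_sum hW (k + 1) K i) (averagingProduct_row_sum hW (k + 1) K i')
        (hK (k + 1) K le_rfl i i') (norm_sub_le_spread (u k))
      have h5 : (n : ℝ) * (1 / (2 * n) * spread (u k)) = spread (u k) / 2 := by
        field_simp
      rw [h5] at h4
      rw [norm_sub_rev] at h3
      have h6 := norm_sub_le_norm_sub_add_norm_sub (u (k + K) i)
        (∑ l, averagingProduct W (k + 1) K i l • u k l) (u (k + K) i')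
      have h7 := norm_sub_le_norm_sub_add_norm_sub
        (∑ l, averagingProduct W (k + 1) K i l • u k l)
        (∑ l, averagingProduct W (k + 1) K i' l • u k l) (u (k + K) i')
      linarith
    rw [div_le_iff₀ (hR _)]
    have h2 : spread (u k) ≤ spread (u k) / runningBound u k * runningBound u (k + K) := by
      rw [div_mul_eq_mul_div, le_div_iff₀ (hR _)]
      exact mul_le_mul_of_nonneg_left (runningBound_mono u (by omega)) (spread_nonneg _)
    linarith
  -- (r/2 + 2c)² ≤ r²/2 + 8c².
  refine summable_of_le_half_add (c := fun k => 8 * c k ^ 2) K (fun k => sq_nonneg _)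
    (hcs.mul_left 8) (fun k => by positivity) fun k => ?_
  have h0 : 0 ≤ spread (u (k + K)) / runningBound u (k + K) :=
    div_nonneg (spread_nonneg _) (hR _).le
  have h1 := pow_le_pow_left₀ h0 (hrec k) 2
  nlinarith [sq_nonneg (spread (u k) / runningBound u k / 2 - 2 * c k)]

/-- The averages do not vary much over the last `H` iterations. -/
theorem exists_summable_sq_variation [NeZero n] (hd : DelayedDescent W α H conn σ C u y)
    (hW : WeightAssumptions W) (hC : 0 ≤ C) (hα : StepsizeAssumptions α) :
    ∃ b : ℕ → ℝ, (∀ k, 0 ≤ b k) ∧ (Summable fun k => b k ^ 2) ∧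
      ∀ k q τ l, τ ≤ k → k ≤ τ + H → ‖u τ q - u k l‖ ≤ b k * runningBound u k := by
  have hR : ∀ k, 0 < runningBound u k := fun k =>
    zero_lt_one.trans_le (one_le_runningBound u k)
  have hα3 : ∀ k, 0 ≤ 3 * C * α k := fun k => mul_nonneg (by linarith) (hα.pos _).le
  set d : ℕ → ℝ := fun k =>
    spread (u k) / runningBound u k + ∑ s ∈ Finset.range H, 3 * C * α (k + s) with hdd
  have hd0 : ∀ k, 0 ≤ d k := fun k => add_nonneg (div_nonneg (spread_nonneg _) (hR _).le)
    (Finset.sum_nonneg fun s _ => hα3 _)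
  have hds : Summable fun k => d k ^ 2 :=
    summable_sq_add (hd.summable_sq_spread_div hW hC hα)
      (summable_sq_sum _ fun s _ => summable_sq_const_mul (3 * C)
        (summable_sq_shift_add s hα.summable_sq))
  -- The evaluation time is unknown within the window, so its bound is summed over all delays;
  -- truncated subtraction at early times merely repeats `d 0`.
  refine ⟨fun k => ∑ h ∈ Finset.range (H + 1), d (k - h),
    fun k => Finset.sum_nonneg fun _ _ => hd0 _,
    summable_sq_sum _ fun h _ => summable_sq_shift_sub h hds, fun k q τ l hτ hk => ?_⟩
  have h1 : d τ ≤ ∑ h ∈ Finset.range (H + 1), d (k - h) := by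
    have := Finset.single_le_sum (f := fun h => d (k - h)) (fun _ _ => hd0 _)
      (Finset.mem_range.2 (show k - τ < H + 1 by omega))
    simpa [Nat.sub_sub_self hτ] using this
  refine le_trans ?_ (mul_le_mul_of_nonneg_right h1 (hR k).le)
  obtain ⟨t, rfl⟩ := Nat.exists_eq_add_of_le hτ
  have h2 := hd.norm_sub_averagingProduct_le hW hC hα.pos τ t l
  have h3 : ‖∑ j, averagingProduct W (τ + 1) t l j • u τ j - u τ q‖ ≤ spread (u τ) :=
    norm_weighted_sum_sub_const_le (averagingProduct_nonneg hW _ _ l)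
      (averagingProduct_row_sum hW _ _ l) fun j => norm_sub_le_spread _ j q
  have h4 : (∑ s ∈ Finset.range t, 3 * C * α (τ + s)) * runningBound u (τ + t) ≤
      (∑ s ∈ Finset.range H, 3 * C * α (τ + s)) * runningBound u (τ + t) :=
    mul_le_mul_of_nonneg_right (Finset.sum_le_sum_of_subset_of_nonneg
      (Finset.range_mono (by omega)) fun s _ _ => hα3 _) (hR _).le
  have h5 : spread (u τ) ≤ spread (u τ) / runningBound u τ * runningBound u (τ + t) := by
    rw [div_mul_eq_mul_div, le_div_iff₀ (hR _)]
    exact mul_le_mul_of_nonneg_left (runningBound_mono u hτ) (spread_nonneg _)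
  have h6 := norm_sub_le_norm_sub_add_norm_sub (u (τ + t) l)
    (∑ j, averagingProduct W (τ + 1) t l j • u τ j) (u τ q)
  rw [norm_sub_rev, hdd]
  simp only [add_mul]
  linarith

-- Expanding the square, the cross term yields the descent up to 2Cαb R² from replacing h by g, and
-- the quadratic term costs 9C²α² R².
open scoped Classical in
theorem norm_sq_step_le (hd : DelayedDescent W α H conn σ C u y) (hC : 0 ≤ C)
    (hα : ∀ k, 0 < α k) {b : ℕ → ℝ} (hb0 : ∀ k, 0 ≤ b k)
    (hb : ∀ k q τ l, τ ≤ k → k ≤ τ + H → ‖u τ q - u k l‖ ≤ b k * runningBound u k)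
    (k : ℕ) (l : Fin n) :
    ‖y k l‖ ^ 2 ≤ ‖u k l‖ ^ 2 - 2 * σ * α k * ((if conn k l then 1 else 0) * ‖u k l‖ ^ 2) +
      (2 * C + 9 * C ^ 2) * (α k * (b k + α k)) * runningBound u k ^ 2 := by
  have hαk := hα k
  have hbk := hb0 k
  have hR := one_le_runningBound u k
  by_cases hc : conn k l
  · obtain ⟨g, h, h1, h2, h3, h4⟩ := hd.exists_direction hC hc
    have h5 := h4 _ fun q τ => hb k q τ l
    have h6 : ⟪h, u k l⟫ - C * b k * runningBound u k ^ 2 ≤ ⟪g, u k l⟫ := by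
      have h7 := abs_le.1 (abs_real_inner_le_norm (g - h) (u k l))
      have h8 : ‖g - h‖ * ‖u k l‖ ≤ C * (b k * runningBound u k) * runningBound u k :=
        mul_le_mul h5 (norm_le_runningBound u (le_refl k) l) (norm_nonneg _) (by positivity)
      rw [inner_sub_left] at h7
      linarith [h7.1]
    have h9 : ‖g‖ ^ 2 ≤ 9 * C ^ 2 * runningBound u k ^ 2 := by
      have := pow_le_pow_left₀ (norm_nonneg g) h3 2
      linarith
    rw [h1, norm_sub_sq_real, norm_smul, inner_smul_right, Real.norm_of_nonneg hαk.le, mul_pow,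
      real_inner_comm, if_pos hc, one_mul]
    have h10 := mul_le_mul_of_nonneg_left h9 (sq_nonneg (α k))
    have h11 := mul_le_mul_of_nonneg_left (h2.trans (sub_le_iff_le_add.1 h6)) hαk.le
    have h12 : 0 ≤ C * α k * α k * runningBound u k ^ 2 := by positivity
    have h13 : 0 ≤ C ^ 2 * α k * b k * runningBound u k ^ 2 := by positivity
    nlinarith
  · rw [hd.idle k l hc, if_neg hc]
    have : 0 ≤ (2 * C + 9 * C ^ 2) * (α k * (b k + α k)) * runningBound u k ^ 2 := by positivity
    linarith

open scoped Classical in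
/-- If the total weighted stepsize of the connected servers is infinite, then all servers converge
to the origin. -/
theorem tendsto_zero [NeZero n] (hd : DelayedDescent W α H conn σ C u y)
    (hW : WeightAssumptions W) (hC : 0 ≤ C) (hσ : 0 < σ) (hα : StepsizeAssumptions α)
    {π : ℕ → Fin n → ℝ} (hπ0 : ∀ r l, 0 ≤ π r l) (hπ1 : ∀ r, ∑ l, π r l = 1)
    (hπW : ∀ r l, ∑ i, π (r + 1) i * W r i l = π r l)
    (hsum : ¬ Summable fun k => α k * ∑ l, π (k + 1) l * (if conn k l then 1 else 0 : ℝ))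
    (i : Fin n) :
    Tendsto (fun k => u k i) atTop (𝓝 0) ∧ Tendsto (fun k => y k i) atTop (𝓝 0) := by
  obtain ⟨b, hb0, hbs, hb⟩ := hd.exists_summable_sq_variation hW hC hα
  have hR1 := one_le_runningBound u
  set Z : ℕ → ℝ := fun k => ∑ l, π (k + 1) l * (if conn k l then 1 else 0 : ℝ) with hZ
  have hZ0 : ∀ k, 0 ≤ Z k := fun k =>
    Finset.sum_nonneg fun l _ => mul_nonneg (hπ0 _ l) (by split_ifs <;> norm_num)
  have hZ1 : ∀ k, Z k ≤ 1 := fun k => by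
    rw [← hπ1 (k + 1)]
    exact Finset.sum_le_sum fun l _ => mul_le_of_le_one_right (hπ0 _ l)
      (by split_ifs <;> norm_num)
  -- The index k + 1 matches the next averaging matrix: π(k+2) W(k+1) = π(k+1).
  set V : ℕ → ℝ := fun k => ∑ l, π (k + 1) l * ‖u k l‖ ^ 2 with hV
  have hV0 : ∀ k, 0 ≤ V k := fun k =>
    Finset.sum_nonneg fun l _ => mul_nonneg (hπ0 _ l) (sq_nonneg _)
  have hconst : ∀ k (c : ℝ), ∑ l, π (k + 1) l * c = c := fun k c => by
    rw [← Finset.sum_mul, hπ1, one_mul]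
  -- Near-consensus makes each squared norm comparable to V, so descent at the connected servers
  -- alone decreases the whole of V.
  have hdiff : ∀ k l l', ‖u k l‖ ^ 2 ≤ ‖u k l'‖ ^ 2 + 2 * b k * runningBound u k ^ 2 := by
    intro k l l'
    have h1 : ‖u k l‖ - ‖u k l'‖ ≤ b k * runningBound u k :=
      (norm_sub_norm_le _ _).trans (hb k l k l' le_rfl (by omega))
    have h2 := norm_le_runningBound u (le_refl k) l
    have h3 := norm_le_runningBound u (le_refl k) l'
    have h4 := mul_le_mul_of_nonneg_right h1 (add_nonneg (norm_nonneg (u k l))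
      (norm_nonneg (u k l')))
    have h5 : b k * runningBound u k * (‖u k l‖ + ‖u k l'‖) ≤
        b k * runningBound u k * (2 * runningBound u k) :=
      mul_le_mul_of_nonneg_left (by linarith)
        (mul_nonneg (hb0 k) (zero_le_one.trans (hR1 k)))
    linarith
  have huV : ∀ k l, ‖u k l‖ ^ 2 ≤ V k + 2 * b k * runningBound u k ^ 2 := by
    intro k l
    rw [← hconst k (‖u k l‖ ^ 2), ← hconst k (2 * b k * runningBound u k ^ 2), hV,
      ← Finset.sum_add_distrib]
    simp only [← mul_add]
    exact Finset.sum_le_sum fun l' _ => mul_le_mul_of_nonneg_left (hdiff k l l') (hπ0 _ _)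
  have hVu : ∀ k l, V k ≤ ‖u k l‖ ^ 2 + 2 * b k * runningBound u k ^ 2 := by
    intro k l
    rw [← hconst k (‖u k l‖ ^ 2 + _), hV]
    exact Finset.sum_le_sum fun l' _ => mul_le_mul_of_nonneg_left (hdiff k l' l) (hπ0 _ _)
  have hVR : ∀ k, V k ≤ runningBound u k ^ 2 := by
    intro k
    rw [← hconst k (runningBound u k ^ 2), hV]
    exact Finset.sum_le_sum fun l _ => mul_le_mul_of_nonneg_left
      (pow_le_pow_left₀ (norm_nonneg _) (norm_le_runningBound u (le_refl k) l) 2) (hπ0 _ _)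
  -- The extra 4σ pays for replacing ‖u k l‖² by V - 2bR² in the descent term 2σα‖u k l‖².
  set e : ℕ → ℝ := fun k => (2 * C + 9 * C ^ 2 + 4 * σ) * (α k * (b k + α k)) with he
  have he0 : ∀ k, 0 ≤ e k := fun k => by
    have := hα.pos k
    have := hb0 k
    positivity
  have hes : Summable e := (summable_mul_of_sq (fun k => (hα.pos k).le)
    (fun k => add_nonneg (hb0 k) (hα.pos k).le) hα.summable_sq
    (summable_sq_add hbs hα.summable_sq)).mul_left _
  have hstep : ∀ k, V (k + 1) ≤ V k - 2 * σ * (α k * Z k) * V k + e k * runningBound u k ^ 2 := by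
    intro k
    have hαk := hα.pos k
    have h1 : V (k + 1) ≤ ∑ l, π (k + 1) l * ‖y k l‖ ^ 2 := by
      calc V (k + 1) ≤ ∑ i, π (k + 2) i * ∑ l, W (k + 1) i l * ‖y k l‖ ^ 2 := by
            refine Finset.sum_le_sum fun i _ => mul_le_mul_of_nonneg_left ?_ (hπ0 _ _)
            rw [hd.average]
            exact norm_sq_weighted_sum_le (hW.nonneg _ i) (hW.row_sum _ i) _
        _ = ∑ l, π (k + 1) l * ‖y k l‖ ^ 2 := by
            simp only [Finset.mul_sum, ← hπW (k + 1), Finset.sum_mul]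
            rw [Finset.sum_comm]
            simp only [mul_assoc]
    have h2 : ∑ l, π (k + 1) l * ‖y k l‖ ^ 2 ≤ ∑ l, π (k + 1) l * (‖u k l‖ ^ 2 -
        2 * σ * α k * ((if conn k l then 1 else 0) * (V k - 2 * b k * runningBound u k ^ 2)) +
        (2 * C + 9 * C ^ 2) * (α k * (b k + α k)) * runningBound u k ^ 2) := by
      refine Finset.sum_le_sum fun l _ => mul_le_mul_of_nonneg_left
        ((hd.norm_sq_step_le hC hα.pos hb0 hb k l).trans ?_) (hπ0 _ _)
      have h3 : (if conn k l then 1 else 0 : ℝ) * (V k - 2 * b k * runningBound u k ^ 2) ≤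
          (if conn k l then 1 else 0) * ‖u k l‖ ^ 2 :=
        mul_le_mul_of_nonneg_left (by linarith [hVu k l]) (by split_ifs <;> norm_num)
      have h4 := mul_le_mul_of_nonneg_left h3 (show 0 ≤ 2 * σ * α k by positivity)
      linarith
    have h3 : ∑ l, π (k + 1) l * (‖u k l‖ ^ 2 -
        2 * σ * α k * ((if conn k l then 1 else 0) * (V k - 2 * b k * runningBound u k ^ 2)) +
        (2 * C + 9 * C ^ 2) * (α k * (b k + α k)) * runningBound u k ^ 2) =
        V k - 2 * σ * α k * (Z k * (V k - 2 * b k * runningBound u k ^ 2)) +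
        (2 * C + 9 * C ^ 2) * (α k * (b k + α k)) * runningBound u k ^ 2 := by
      have hterm : ∀ l (A B : ℝ), π (k + 1) l * (A - 2 * σ * α k * ((if conn k l then 1 else 0) *
          B)) = π (k + 1) l * A - (π (k + 1) l * (if conn k l then 1 else 0)) *
          (2 * σ * α k * B) := fun l A B => by ring
      simp only [mul_add (π _ _), hterm, Finset.sum_add_distrib, Finset.sum_sub_distrib, hconst,
        ← Finset.sum_mul]
      simp only [hV, hZ]
      ring
    have h4 : 4 * σ * α k * b k * runningBound u k ^ 2 * Z k ≤
        4 * σ * α k * b k * runningBound u k ^ 2 := by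
      have := hb0 k
      exact mul_le_of_le_one_right (by positivity) (hZ1 k)
    have h5 : 0 ≤ 4 * σ * α k * α k * runningBound u k ^ 2 := by positivity
    rw [h3] at h2
    refine (h1.trans h2).trans ?_
    simp only [he]
    linarith
  obtain ⟨B, hB⟩ := exists_runningBound_le he0 hes (tendsto_zero_of_summable_sq hbs) hVR huV
    fun k => (hstep k).trans (by
      have : 0 ≤ 2 * σ * (α k * Z k) * V k :=
        mul_nonneg (mul_nonneg (by positivity) (mul_nonneg (hα.pos k).le (hZ0 k))) (hV0 k)
      linarith)
  have hB2 : ∀ k, runningBound u k ^ 2 ≤ B ^ 2 := fun k =>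
    pow_le_pow_left₀ (zero_le_one.trans (hR1 k)) (hB k) 2
  have hVlim : Tendsto V atTop (𝓝 0) := by
    refine tendsto_zero_of_descent (z := fun k => 2 * σ * (α k * Z k))
      (e := fun k => e k * B ^ 2) hV0 (fun k => mul_nonneg (by positivity)
        (mul_nonneg (hα.pos k).le (hZ0 k))) ?_ (fun k => mul_nonneg (he0 k) (sq_nonneg _))
      (hes.mul_right _) fun k => (hstep k).trans ?_
    · rwa [summable_mul_left_iff (by positivity)]
    · have := mul_le_mul_of_nonneg_left (hB2 k) (he0 k)
      linarith
  have hu : Tendsto (fun k => u k i) atTop (𝓝 0) := by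
    rw [tendsto_zero_iff_norm_tendsto_zero]
    have h1 : Tendsto (fun k => V k + 2 * b k * B ^ 2) atTop (𝓝 0) := by
      simpa using hVlim.add (((tendsto_zero_of_summable_sq hbs).const_mul 2).mul_const (B ^ 2))
    have h2 : Tendsto (fun k => ‖u k i‖ ^ 2) atTop (𝓝 0) := by
      refine squeeze_zero (fun k => sq_nonneg _) (fun k => (huV k i).trans ?_) h1
      have := mul_le_mul_of_nonneg_left (hB2 k) (show 0 ≤ 2 * b k by linarith [hb0 k])
      linarith
    simpa [Real.sqrt_sq (norm_nonneg _)] using h2.sqrt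
  refine ⟨hu, ?_⟩
  have hstep0 : Tendsto (fun k => y k i - u k i) atTop (𝓝 0) := by
    rw [tendsto_zero_iff_norm_tendsto_zero]
    have h1 : Tendsto (fun k => 3 * C * α k * B) atTop (𝓝 0) := by
      simpa using (hα.tendsto_zero.const_mul (3 * C)).mul_const B
    refine squeeze_zero (fun k => norm_nonneg _)
      (fun k => (hd.norm_step_le hC hα.pos k i).trans ?_) h1
    exact mul_le_mul_of_nonneg_left (hB k) (mul_nonneg (by linarith) (hα.pos k).le)
  simpa using hstep0.add hu

end DelayedDescent

end Descent

/-! ### Reduction of SRDO to the recursion, and almost sure convergence -/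

/-- Every realization of the algorithm, centred at a common minimizer of the partition functions,
is an averaging recursion with delayed descent steps. -/
theorem IsRun.delayedDescent {N n p : ℕ} {Ω : Type*} {m s : Fin p → ℕ}
    {code : ∀ j, GradientCode (m j) (s j)} {f : ∀ j, Fin (m j) → Point N → ℝ}
    {X : Set (Point N)} {L G : ℝ} (hf : FunctionAssumptions f X L G)
    {W : ℕ → Matrix (Fin n) (Fin n) ℝ} (hW : WeightAssumptions W) {H : ℕ} {α : ℕ → ℝ}
    {sel : ℕ → Fin n → Ω → Option (Fin p)} {σ : ℝ}
    (hstrong : ∀ j, StrongConvexOn Set.univ σ (partitionFun f j)) {z : Point N}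
    (hz : ∀ j y, partitionFun f j z ≤ partitionFun f j y)
    {Γ : ℕ → Fin n → (j : Fin p) → Ω → Finset (Fin (m j))}
    {src : ℕ → Fin n → (j : Fin p) → Fin (m j) → Ω → Fin n}
    {time : ℕ → Fin n → (j : Fin p) → Fin (m j) → Ω → ℕ} {x v : ℕ → Fin n → Ω → Point N}
    (hrun : IsRun code f W α H sel Γ src time x v) (ω : Ω) :
    DelayedDescent W α H (fun k l => sel k l ω ≠ none) (σ / 2)
      (|L| + ∑ j, (code j).gain * |L|) (fun k l => v k l ω - z) (fun k l => x (k + 1) l ω - z) := by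
  have hgain : ∀ j, (code j).gain * |L| ≤ |L| + ∑ j, (code j).gain * |L| := fun j =>
    (Finset.single_le_sum (f := fun j => (code j).gain * |L|)
      (fun j _ => mul_nonneg (code j).gain_nonneg (abs_nonneg L)) (Finset.mem_univ j)).trans
      (le_add_of_nonneg_left (abs_nonneg L))
  refine ⟨fun k i => ?_, fun k l hc => ?_, fun k l hc => ?_⟩
  · simp only [smul_sub, Finset.sum_sub_distrib, ← Finset.sum_smul, hW.row_sum, one_smul,
      hrun.average k i ω]
  · simp only [hrun.step_none k l ω (not_not.1 hc)]
  · obtain ⟨j, hj⟩ := Option.ne_none_iff_exists'.1 hc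
    obtain ⟨I, hI, hx⟩ := hrun.step_some k l j ω hj
    -- Here g is the decoded gradient and h the true partition gradient at the server's own average.
    refine ⟨_, gradient (partitionFun f j) (v k l ω), by rw [hx, sub_right_comm],
      inner_gradient_ge_of_strongConvexOn (hstrong j) (hf.differentiable j _) (hz j), ?_,
      fun B hB => ?_⟩
    · have h1 := hf.lipschitz j (v k l ω) z
      rw [gradient_eq_zero_of_forall_le (hz j), sub_zero] at h1
      refine h1.trans (mul_le_mul_of_nonneg_right ((le_abs_self L).trans ?_) (norm_nonneg _))
      exact le_add_of_nonneg_right (Finset.sum_nonneg fun j _ =>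
        mul_nonneg (code j).gain_nonneg (abs_nonneg L))
    · have hB0 : 0 ≤ B := (norm_nonneg _).trans (hB l k le_rfl (Nat.le_add_right k H))
      -- The true gradient is what decoding returns when every worker evaluates at `v k l ω`, so
      -- only staleness remains to be bounded.
      rw [gradient_partitionFun hf, ← (code j).decodedGradient_const (f j) hI]
      refine ((code j).norm_decodedGradient_sub_le (hf.local_lipschitz j) I _
        (fun w hw => ?_) hB0).trans ?_
      · have := hB (src k l j w ω) (time k l j w ω) (hrun.delay k l j w ω hj hw).1
          (hrun.delay k l j w ω hj hw).2
        rwa [sub_sub_sub_cancel_right] at this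
      · rw [← mul_assoc]
        exact mul_le_mul_of_nonneg_right (hgain j) hB0

end SRDO

end

theorem mainTheorem1 {N n p : ℕ} {Ω : Type*} [mΩ : MeasurableSpace Ω]
    (μ : Measure Ω) [IsProbabilityMeasure μ]
    (m s : Fin p → ℕ) (code : ∀ j, SRDO.GradientCode (m j) (s j))
    (f : ∀ j, Fin (m j) → SRDO.Point N → ℝ)
    (X : Set (SRDO.Point N)) (L G : ℝ) (hf : SRDO.FunctionAssumptions f X L G)
    (W : ℕ → Matrix (Fin n) (Fin n) ℝ) (hW : SRDO.WeightAssumptions W)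
    (H : ℕ)
    (ℱ : Filtration ℕ mΩ) (γ : Option (Fin p) → ℝ) (sel : ℕ → Fin n → Ω → Option (Fin p))
    (hsel : SRDO.SelectionAssumptions μ ℱ γ sel)
    (α : ℕ → ℝ) (hα : SRDO.StepsizeAssumptions α)
    (hstrong : ∀ j, ∃ σ > 0, StrongConvexOn Set.univ σ (SRDO.partitionFun f j))
    (xstar : SRDO.Point N) (hxstar : xstar ∈ SRDO.optimalSet f)
    (xpart : Fin p → SRDO.Point N)
    (hxpart : ∀ j y, SRDO.partitionFun f j (xpart j) ≤ SRDO.partitionFun f j y)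
    (hcommon : ∀ j, SRDO.partitionFun f j xstar = SRDO.partitionFun f j (xpart j))
    (Γ : ℕ → Fin n → (j : Fin p) → Ω → Finset (Fin (m j)))
    (src : ℕ → Fin n → (j : Fin p) → Fin (m j) → Ω → Fin n)
    (time : ℕ → Fin n → (j : Fin p) → Fin (m j) → Ω → ℕ)
    (x v : ℕ → Fin n → Ω → SRDO.Point N)
    (hrun : SRDO.IsRun code f W α H sel Γ src time x v) :
    ∃ xlim : Ω → SRDO.Point N, Measurable xlim ∧
      ∀ᵐ ω ∂μ, xlim ω ∈ SRDO.optimalSet f ∧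
        ∀ i, Tendsto (fun k => x k i ω) atTop (𝓝 (xlim ω)) ∧
          Tendsto (fun k => v k i ω) atTop (𝓝 (xlim ω)) := by
  refine ⟨fun _ => xstar, measurable_const, ?_⟩
  rcases Nat.eq_zero_or_pos n with hn | hn
  · subst hn
    exact Eventually.of_forall fun ω => ⟨hxstar, fun i => i.elim0⟩
  have : NeZero n := ⟨hn.ne'⟩
  -- The smallest of the finitely many moduli serves all partitions.
  obtain ⟨σ, hσ, hstrongσ⟩ : ∃ σ > 0, ∀ j,
      StrongConvexOn Set.univ σ (SRDO.partitionFun f j) := by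
    choose τ hτ hτf using hstrong
    rcases isEmpty_or_nonempty (Fin p) with hp | hp
    · exact ⟨1, one_pos, fun j => isEmptyElim j⟩
    · obtain ⟨j0, hj0⟩ := Finite.exists_min τ
      exact ⟨τ j0, hτ j0, fun j => (hτf j).mono (hj0 j)⟩
  have hz : ∀ j y, SRDO.partitionFun f j xstar ≤ SRDO.partitionFun f j y := fun j y =>
    (hcommon j).trans_le (hxpart j y)
  obtain ⟨π, hπ0, hπ1, hπW⟩ := SRDO.exists_absolute_probability hW
  -- The weights are shifted by one to agree with those in V.
  filter_upwards [SRDO.ae_not_summable_connected hsel hα (π := fun k => π (k + 1))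
    (fun r => hπ0 (r + 1)) (fun r => hπ1 (r + 1))] with ω hω
  refine ⟨hxstar, fun i => ?_⟩
  have hC : 0 ≤ |L| + ∑ j, (code j).gain * |L| := add_nonneg (abs_nonneg L)
    (Finset.sum_nonneg fun j _ => mul_nonneg (code j).gain_nonneg (abs_nonneg L))
  obtain ⟨hv, hx⟩ := (hrun.delayedDescent hf hW hstrongσ hz ω).tendsto_zero hW hC (half_pos hσ) hα
    hπ0 hπ1 hπW (fun h => hω (h.congr fun k => by congr! 3 with l; split_ifs <;> simp_all)) i
  exact ⟨(tendsto_add_atTop_iff_nat 1).1 (tendsto_sub_nhds_zero_iff.1 hx),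
    tendsto_sub_nhds_zero_iff.1 hv⟩
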